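/- Notation. For a differentiable vector field $V=(V_1,V_2,V_3)$ on an open subset of $\mathbb{R}^3$ let $\nabla V=(\partial_jV_i)_{ij}$, $D_\pm V=\tfrac12(\nabla V\pm{}^t(\nabla V))$ and $\operatorname{div}V=\sum_i\partial_iV_i$. For a $3\times3$ matrix $M$ put $|M|^2=\sum_{i,j}M_{ij}^2$; for a $C^1$ matrix field $S$, $\operatorname{div}S$ is the vector field with components $(\operatorname{div}S)_i=\sum_j\partial_jS_{ij}$. A bounded $C^2$-domain in $\mathbb{R}^3$ is a bounded, nonempty, connected open set that, near each of its boundary points, is the set $\{g<0\}$ of a $C^2$ function $g$ whose gradient does not vanish at that point. Theorem 2.3 (Viscous and pressure terms, incompressible case). Let $T\in(0,\infty]$, let $\Omega(t)$, $0\le t<T$, be bounded $C^2$-domains in $\mathbb{R}^3$, and let $e_1,e_2,e_3:\mathbb{R}\to\mathbb{R}$ be $C^1$ functions. Fix $t\in(0,T)$. Let $\rho,\sigma_0$ be real-valued functions and $v,F$ be $\mathbb{R}^3$-valued functions of $(x,t)$ that at the fixed time $t$ are $C^1$ in $x\in\Omega(t)$, and suppose that the viscous stress $$S=e_1'(|D_+v|^2)\,D_+v+e_3'(|D_-v|^2)\,D_-v$$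 is $C^1$ in $\Omega(t)$. For a vector field $V$ on $\Omega(t)$ set $$E_{D+W}[V](t)=-\int_{\Omega(t)}\tfrac12\left\{e_1(|D_+V|^2)+e_2(|\operatorname{div}V|^2)+e_3(|D_-V|^2)\right\}dx+\int_{\Omega(t)}\left\{(\operatorname{div}V)\,\sigma_0+\rho F\cdot V\right\}dx,$$ and suppose that both integrands are integrable over $\Omega(t)$ for $V=v$. Suppose that $\operatorname{div}v=0$ in $\Omega(t)$ and that for every $\varphi\in[C_0^\infty(\Omega(t))]^3$ with $\operatorname{div}\varphi=0$, $$\frac{d}{d\varepsilon}\Big|_{\varepsilon=0}E_{D+W}[v+\varepsilon\varphi](t)=0.$$ Then there is a function $\sigma\in C^1(\Omega(t))$ such that $$\operatorname{div}\left\{e_1'(|D_+v|^2)\,D_+v+e_3'(|D_-v|^2)\,D_-v\right\}+\rho F=\nabla\sigma\quad\text{in }\Omega(t).$$ -/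

import Mathlib

open MeasureTheory
open scoped ContDiff

noncomputable section

namespace NonNewtonian

/-- Three-dimensional Euclidean space. -/
abbrev E3 := EuclideanSpace ℝ (Fin 3)

/-- The partial derivative of `f` in the `j`-th coordinate direction at `x`. -/
def partialD {X : Type*} [NormedAddCommGroup X] [NormedSpace ℝ X]
    (j : Fin 3) (f : E3 → X) (x : E3) : X :=
  fderiv ℝ f x (EuclideanSpace.single j 1)

/-- The velocity gradient: the entry `(i, j)` is the `j`-th partial derivative of `V i`. -/
def gradMat (V : E3 → E3) (x : E3) : Matrix (Fin 3) (Fin 3) ℝ :=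
  Matrix.of fun i j => partialD j (fun y => V y i) x

/-- The divergence of a vector field. -/
def divergence (V : E3 → E3) (x : E3) : ℝ :=
  ∑ i, partialD i (fun y => V y i) x

/-- The strain rate tensor `D₊(V)`. -/
def strainRate (V : E3 → E3) (x : E3) : Matrix (Fin 3) (Fin 3) ℝ :=
  (1 / 2 : ℝ) • (gradMat V x + (gradMat V x).transpose)

/-- The vorticity tensor `D₋(V)`. -/
def vorticity (V : E3 → E3) (x : E3) : Matrix (Fin 3) (Fin 3) ℝ :=
  (1 / 2 : ℝ) • (gradMat V x - (gradMat V x).transpose)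

/-- `|M|² = M : M`, the sum of the squares of all entries. -/
def matNormSq (M : Matrix (Fin 3) (Fin 3) ℝ) : ℝ :=
  ∑ i, ∑ j, M i j * M i j

/-- The row-wise divergence of a matrix field; its `i`-th component is `∑ j, ∂ⱼ (S i j)`. -/
def matDiv (S : E3 → Matrix (Fin 3) (Fin 3) ℝ) (x : E3) : E3 :=
  WithLp.toLp 2 fun i => ∑ j, partialD j (fun y => S y i j) x

/-- The viscous stress `e₁'(|D₊(V)|²) D₊(V) + e₃'(|D₋(V)|²) D₋(V)`. -/
def viscousStress (e₁ e₃ : ℝ → ℝ) (V : E3 → E3) (x : E3) : Matrix (Fin 3) (Fin 3) ℝ :=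
  deriv e₁ (matNormSq (strainRate V x)) • strainRate V x
    + deriv e₃ (matNormSq (vorticity V x)) • vorticity V x

/-- The density `½ {e₁(|D₊(V)|²) + e₂(|div V|²) + e₃(|D₋(V)|²)}` of energy dissipation. -/
def dissipationDensity (e₁ e₂ e₃ : ℝ → ℝ) (V : E3 → E3) (x : E3) : ℝ :=
  1 / 2 * (e₁ (matNormSq (strainRate V x)) + e₂ (|divergence V x| ^ 2)
    + e₃ (matNormSq (vorticity V x)))

/-- The power density `(div V) σ + ρ F · V`. -/
def powerDensity (σ ρ : E3 → ℝ) (F V : E3 → E3) (x : E3) : ℝ :=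
  divergence V x * σ x + ρ x * inner ℝ (F x) (V x)

/-- The dissipation energy `E_D[V]` over the domain `Ω`. -/
def dissipationEnergy (e₁ e₂ e₃ : ℝ → ℝ) (Ω : Set E3) (V : E3 → E3) : ℝ :=
  -∫ x in Ω, dissipationDensity e₁ e₂ e₃ V x

/-- The work `E_W[V]` over the domain `Ω`. -/
def workEnergy (σ ρ : E3 → ℝ) (F : E3 → E3) (Ω : Set E3) (V : E3 → E3) : ℝ :=
  ∫ x in Ω, powerDensity σ ρ F V x

/-- `E_{D+W}[V] = E_D[V] + E_W[V]`. -/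
def totalEnergy (e₁ e₂ e₃ : ℝ → ℝ) (σ ρ : E3 → ℝ) (F : E3 → E3) (Ω : Set E3)
    (V : E3 → E3) : ℝ :=
  dissipationEnergy e₁ e₂ e₃ Ω V + workEnergy σ ρ F Ω V

/-- A bounded `C²`-domain: a bounded nonempty connected open set which, near every boundary
point, is the negative set of a `C²` function whose gradient does not vanish at that point
(so that, near that point, the boundary is a `C²` surface with the domain on one side). -/
structure IsBoundedC2Domain (Ω : Set E3) : Prop where
  isOpen : IsOpen Ω
  isConnected : IsConnected Ω
  isBounded : Bornology.IsBounded Ω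
  boundary : ∀ p ∈ frontier Ω, ∃ U : Set E3, IsOpen U ∧ p ∈ U ∧ ∃ g : E3 → ℝ,
    ContDiffOn ℝ 2 g U ∧ fderiv ℝ g p ≠ 0 ∧ ∀ x ∈ U, x ∈ Ω ↔ g x < 0

/-- `φ ∈ [C₀^∞(Ω)]³` with `div φ = 0`. -/
structure IsSolenoidalTestField (Ω : Set E3) (φ : E3 → E3) : Prop where
  smooth : ContDiff ℝ ∞ φ
  hasCompactSupport : HasCompactSupport φ
  tsupport_subset : tsupport φ ⊆ Ω
  divergence_eq_zero : ∀ x, divergence φ x = 0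

end NonNewtonian

end

/-!
Write `S` for the viscous stress and `G = div S + ρ F`. Since `v` and the test fields `φ` are
solenoidal, the `e₂` and `σ₀` terms do not contribute to the first variation, which is therefore
`-∫ S : ∇φ + ∫ ρ F · φ` (`hasDerivAt_dissipationEnergy`, `hasDerivAt_workEnergy`; the symmetric and
antisymmetric parts of `∇φ` are separated by `frobenius_viscousStress_gradMat`). Integration by
parts (`integral_frobenius_gradMat`) turns it into `∫ G · φ`. Hence the continuous field `G` is
orthogonal to every solenoidal test field, and it remains to see that it has a potential
(`exists_gradient_eq_of_forall_solenoidal`).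

No topological assumption on the domain beyond connectedness is needed for this last step: a
closed polygon in `Ω`, mollified as a current, is itself a solenoidal test field, so the line
integral of `G` around the polygon vanishes in the limit. This is organised through the relation
`IsWorkBetween Ω G a b r`: for fine mollifiers `η` there are smooth fields `φ`, compactly supported
in `Ω`, with `div φ = η (· - a) - η (· - b)` and `∫ G · φ` close to `r`. The relation is reflexive,
symmetric and additive under concatenation, it holds on segments with `r` the line integral of `G`
(`isWorkBetween_segment`), and it determines `r` because the difference of two such `φ` is
solenoidal. Fixing `a`, the number `r` is a function of `b`, and this function is the potential.
-/

namespace NonNewtonian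

/-! ### Divergence and test fields -/

theorem divergence_add {V W : E3 → E3} {x : E3} (hV : DifferentiableAt ℝ V x)
    (hW : DifferentiableAt ℝ W x) :
    divergence (fun y => V y + W y) x = divergence V x + divergence W x := by
  simp only [divergence, partialD, ← Finset.sum_add_distrib]
  refine Finset.sum_congr rfl fun i _ => ?_
  have hVi : DifferentiableAt ℝ (fun y => V y i) x := by fun_prop
  have hWi : DifferentiableAt ℝ (fun y => W y i) x := by fun_prop
  simp only [PiLp.add_apply]
  rw [fderiv_fun_add hVi hWi]
  rfl

theorem divergence_const_smul {V : E3 → E3} {x : E3} (c : ℝ) (hV : DifferentiableAt ℝ V x) :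
    divergence (fun y => c • V y) x = c * divergence V x := by
  simp only [divergence, partialD, Finset.mul_sum]
  refine Finset.sum_congr rfl fun i _ => ?_
  have hVi : DifferentiableAt ℝ (fun y => V y i) x := by fun_prop
  simp only [PiLp.smul_apply, smul_eq_mul]
  rw [fderiv_const_mul hVi]
  rfl

theorem divergence_add_smul {V φ : E3 → E3} {x : E3} (s : ℝ) (hV : DifferentiableAt ℝ V x)
    (hφ : DifferentiableAt ℝ φ x) :
    divergence (fun y => V y + s • φ y) x = divergence V x + s * divergence φ x := by
  rw [← divergence_const_smul s hφ]
  exact divergence_add hV (hφ.const_smul s)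

theorem divergence_smul_const {ψ : E3 → ℝ} {x : E3} (w : E3) (hψ : DifferentiableAt ℝ ψ x) :
    divergence (fun y => ψ y • w) x = fderiv ℝ ψ x w := by
  have hw : w = ∑ i, w i • EuclideanSpace.single i (1 : ℝ) := by
    ext j
    simp [Finset.sum_apply, Pi.single_apply]
  conv_rhs => rw [hw, map_sum]
  simp only [divergence, partialD, map_smul, PiLp.smul_apply, smul_eq_mul]
  refine Finset.sum_congr rfl fun i _ => ?_
  rw [fderiv_mul_const hψ]
  rfl

/-- The values of `G` outside `Ω` are irrelevant, as `φ` vanishes there. -/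
theorem integrable_inner_of_tsupport_subset {Ω : Set E3} {G φ : E3 → E3}
    (hG : ContinuousOn G Ω) (hφ : Continuous φ) (hc : HasCompactSupport φ)
    (hs : tsupport φ ⊆ Ω) : Integrable fun x => inner ℝ (G x) (φ x) := by
  have h : IntegrableOn (fun x => inner ℝ (G x) (φ x)) (tsupport φ) :=
    ((hG.mono hs).inner hφ.continuousOn).integrableOn_compact hc
  refine (integrableOn_iff_integrable_of_support_subset fun x hx => ?_).1 h
  refine subset_tsupport φ fun h0 => hx ?_
  simp [h0]

/-! ### Mollified segments -/

/-- The mollification by the kernel `η` of the unit mass spread evenly over the segment from `a` to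
`a + w`. The vector field `segmentDensity η a w • w` is the mollified unit current along that
segment. -/
noncomputable def segmentDensity (η : E3 → ℝ) (a w : E3) (x : E3) : ℝ :=
  ∫ s in (0 : ℝ)..1, η (x - (a + s • w))

theorem contDiff_segmentDensity {η : E3 → ℝ} (hη : ContDiff ℝ ∞ η) (hc : HasCompactSupport η)
    (a w : E3) : ContDiff ℝ ∞ (segmentDensity η a w) := by
  set ν : Measure E3 := Measure.map (fun s : ℝ => a + s • w) (volume.restrict (Set.Ioc 0 1))
  have h := hc.contDiff_convolution_right (μ := ν) (n := ⊤) (f := fun _ => (1 : ℝ))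
    (ContinuousLinearMap.lsmul ℝ ℝ) (locallyIntegrable_const 1) hη
  convert h using 1
  ext x
  rw [segmentDensity, convolution_def, integral_map (by fun_prop),
    intervalIntegral.integral_of_le zero_le_one]
  · simp
  · have := hη.continuous
    exact Continuous.aestronglyMeasurable (by fun_prop)

/-- The left side is the divergence of `segmentDensity η a w • w`: the contributions of the interior
of the segment cancel and only the two ends remain. -/
theorem fderiv_segmentDensity {η : E3 → ℝ} (hη : ContDiff ℝ ∞ η) (hc : HasCompactSupport η)
    (a w x : E3) :
    fderiv ℝ (segmentDensity η a w) x w = η (x - a) - η (x - (a + w)) := by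
  have hη0 := hη.continuous
  have hd : DifferentiableAt ℝ (segmentDensity η a w) x :=
    (contDiff_segmentDensity hη hc a w).differentiable (by simp) x
  have h1 : HasDerivAt (fun h : ℝ => segmentDensity η a w (x + h • w))
      (fderiv ℝ (segmentDensity η a w) x w) 0 := by
    have hl : HasDerivAt (fun h : ℝ => x + h • w) w 0 := by
      simpa using ((hasDerivAt_id (0 : ℝ)).smul_const w).const_add x
    have hd' : HasFDerivAt (segmentDensity η a w) (fderiv ℝ (segmentDensity η a w) x)
        (x + (0 : ℝ) • w) := by simpa using hd.hasFDerivAt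
    exact hd'.comp_hasDerivAt 0 hl
  let f : ℝ → ℝ := fun u => η (x - (a + u • w))
  have hf : Continuous f := by fun_prop
  -- translating along `w` amounts to shifting the parameter interval
  have h2 : (fun h : ℝ => segmentDensity η a w (x + h • w))
      = fun h : ℝ => (∫ u in (0 : ℝ)..(1 - h), f u) - ∫ u in (0 : ℝ)..(-h), f u := by
    ext h
    rw [intervalIntegral.integral_interval_sub_left (hf.intervalIntegrable _ _)
      (hf.intervalIntegrable _ _), segmentDensity]
    have := intervalIntegral.integral_comp_sub_right (a := 0) (b := 1) f h
    rw [zero_sub] at this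
    rw [← this]
    refine intervalIntegral.integral_congr fun s _ => ?_
    simp only [f]
    congr 1
    module
  have h3 : HasDerivAt (fun h : ℝ => (∫ u in (0 : ℝ)..(1 - h), f u) - ∫ u in (0 : ℝ)..(-h), f u)
      (f 1 * (-1) - f 0 * (-1)) 0 := by
    have hF : ∀ c, HasDerivAt (fun z => ∫ u in (0 : ℝ)..z, f u) (f c) c := fun c =>
      intervalIntegral.integral_hasDerivAt_right (hf.intervalIntegrable _ _)
        (hf.stronglyMeasurableAtFilter _ _) hf.continuousAt
    have e1 : HasDerivAt (fun h : ℝ => 1 - h) (-1) 0 := (hasDerivAt_id (0 : ℝ)).const_sub 1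
    have e2 : HasDerivAt (fun h : ℝ => -h) (-1) 0 := (hasDerivAt_id (0 : ℝ)).neg
    exact (HasDerivAt.comp (0 : ℝ) (h₂ := fun z => ∫ u in (0 : ℝ)..z, f u)
      (by simpa using hF 1) e1).sub (HasDerivAt.comp (0 : ℝ)
      (h₂ := fun z => ∫ u in (0 : ℝ)..z, f u) (by simpa using hF 0) e2)
  rw [h2] at h1
  rw [h1.unique h3]
  simp [f]
  ring

theorem support_segmentDensity_subset {η : E3 → ℝ} {R : ℝ}
    (hη : Function.support η ⊆ Metric.ball 0 R) (a w : E3) :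
    Function.support (segmentDensity η a w) ⊆ Metric.cthickening R (segment ℝ a (a + w)) := by
  intro x hx
  obtain ⟨s, hs, hne⟩ : ∃ s ∈ Set.Icc (0 : ℝ) 1, η (x - (a + s • w)) ≠ 0 := by
    by_contra! h
    refine hx ?_
    rw [segmentDensity, intervalIntegral.integral_congr (g := fun _ => (0 : ℝ))]
    · simp
    · intro s hs
      rw [Set.uIcc_of_le zero_le_one] at hs
      exact h s hs
  have hb := hη hne
  rw [mem_ball_zero_iff] at hb
  refine Metric.mem_cthickening_of_dist_le x (a + s • w) _ _ ?_ (by rw [dist_eq_norm]; exact hb.le)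
  rw [segment_eq_image']
  exact ⟨s, hs, by simp⟩

/-- `G` integrated against a mollified segment is close to the line integral of `G`. -/
theorem abs_integral_segmentDensity_sub_le {η : ContDiffBump (0 : E3)} {g : E3 → ℝ} {a w : E3}
    {K : Set E3} {δ : ℝ} (hK : IsCompact K)
    (hsub : Metric.cthickening η.rOut (segment ℝ a (a + w)) ⊆ K) (hg : ContinuousOn g K)
    (hδ : ∀ x ∈ K, ∀ y ∈ K, dist x y < η.rOut → dist (g x) (g y) ≤ δ) :
    |(∫ x, g x * segmentDensity (η.normed volume) a w x) - ∫ s in (0 : ℝ)..1, g (a + s • w)|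
      ≤ δ := by
  set θ : E3 → ℝ := η.normed volume with hθ
  have hθc : Continuous θ := η.continuous_normed
  have hseg : ∀ s ∈ Set.Icc (0 : ℝ) 1, a + s • w ∈ segment ℝ a (a + w) := fun s hs => by
    rw [segment_eq_image']
    exact ⟨s, hs, by simp⟩
  have hball : ∀ s ∈ Set.Icc (0 : ℝ) 1, ∀ x, dist x (a + s • w) < η.rOut → x ∈ K :=
    fun s hs x hx => hsub (Metric.mem_cthickening_of_dist_le x _ _ _ (hseg s hs) hx.le)
  have hγK : ∀ s ∈ Set.Icc (0 : ℝ) 1, a + s • w ∈ K := fun s hs =>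
    hball s hs _ (by simpa using η.rOut_pos)
  -- cutting `g` off outside `K` makes it integrable, so that Fubini applies
  let k : E3 → ℝ := K.indicator g
  have hk : Integrable k :=
    (integrable_indicator_iff hK.measurableSet).2 (hg.integrableOn_compact hK)
  have e1 : ∫ x, g x * segmentDensity θ a w x
      = ∫ x, ∫ s in (0 : ℝ)..1, k x * θ (x - (a + s • w)) := by
    refine integral_congr_ae (.of_forall fun x => ?_)
    simp only [intervalIntegral.integral_const_mul]
    change _ = k x * segmentDensity θ a w x
    by_cases hx : x ∈ K
    · simp [k, hx]
    · have : segmentDensity θ a w x = 0 := by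
        by_contra h
        exact hx (hsub (support_segmentDensity_subset (η.support_normed_eq).subset a w h))
      simp [this]
  have e2 : ∫ x, ∫ s in (0 : ℝ)..1, k x * θ (x - (a + s • w))
      = ∫ s in (0 : ℝ)..1, ∫ x, k x * θ (x - (a + s • w)) := by
    refine (intervalIntegral_integral_swap ?_).symm
    rw [Set.uIoc_of_le zero_le_one]
    obtain ⟨C, hC⟩ := η.hasCompactSupport_normed.exists_bound_of_continuous hθc
    exact (hk.comp_snd _).mul_bdd (c := C)
      (Continuous.aestronglyMeasurable (by fun_prop)) (.of_forall fun p => hC _)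
  -- `θ` is even, so the inner integral is a convolution with `θ`
  have e3 : ∀ y, ∫ x, k x * θ (x - y)
      = convolution θ k (ContinuousLinearMap.lsmul ℝ ℝ) volume y := by
    intro y
    rw [convolution_eq_swap]
    refine integral_congr_ae (.of_forall fun x => ?_)
    simp only [ContinuousLinearMap.lsmul_apply, smul_eq_mul]
    rw [hθ, ← η.normed_neg (x - y), neg_sub, mul_comm]
  have e4 : ∀ s ∈ Set.Icc (0 : ℝ) 1,
      ‖(∫ x, k x * θ (x - (a + s • w))) - g (a + s • w)‖ ≤ δ := by
    intro s hs
    have hky : k (a + s • w) = g (a + s • w) := Set.indicator_of_mem (hγK s hs) g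
    rw [e3, ← hky, ← dist_eq_norm]
    refine η.dist_normed_convolution_le hk.aestronglyMeasurable fun x hx => ?_
    rw [Metric.mem_ball] at hx
    have hxK := hball s hs x hx
    rw [hky, show k x = g x from Set.indicator_of_mem hxK g]
    exact hδ _ hxK _ (hγK s hs) hx
  have i1 : IntervalIntegrable (fun s : ℝ => ∫ x, k x * θ (x - (a + s • w))) volume 0 1 := by
    refine Continuous.intervalIntegrable ?_ 0 1
    simp_rw [e3]
    have : Continuous (convolution θ k (ContinuousLinearMap.lsmul ℝ ℝ) volume) :=
      η.hasCompactSupport_normed.continuous_convolution_left _ hθc hk.locallyIntegrable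
    fun_prop
  have i2 : IntervalIntegrable (fun s : ℝ => g (a + s • w)) volume 0 1 := by
    refine ContinuousOn.intervalIntegrable ?_
    rw [Set.uIcc_of_le zero_le_one]
    exact hg.comp (by fun_prop) hγK
  rw [e1, e2, ← intervalIntegral.integral_sub i1 i2, ← Real.norm_eq_abs]
  refine (intervalIntegral.norm_integral_le_of_norm_le_const (C := δ) fun s hs => ?_).trans
    (by simp)
  rw [Set.uIoc_of_le zero_le_one] at hs
  exact e4 s ⟨hs.1.le, hs.2⟩

/-! ### Potentials of fields orthogonal to solenoidal test fields -/

section Potential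

/-- The points `a` and `b` are joined in `Ω` by a unit flux along which `G` has work `r`: for every
fine enough mollifier `η` there is a smooth field `φ`, compactly supported in `Ω`, whose divergence
is the difference of the copies of `η` centred at `a` and at `b`, and the integral of `G · φ` is
close to `r`. -/
def IsWorkBetween (Ω : Set E3) (G : E3 → E3) (a b : E3) (r : ℝ) : Prop :=
  ∀ δ > 0, ∃ R > 0, ∀ η : ContDiffBump (0 : E3), η.rOut < R → ∃ φ : E3 → E3,
    ContDiff ℝ ∞ φ ∧ HasCompactSupport φ ∧ tsupport φ ⊆ Ω ∧
    (∀ x, divergence φ x = η.normed volume (x - a) - η.normed volume (x - b)) ∧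
    |(∫ x, inner ℝ (G x) (φ x)) - r| < δ

variable {Ω : Set E3} {G : E3 → E3} {a b c : E3} {r r' : ℝ}

theorem IsWorkBetween.refl (Ω : Set E3) (G : E3 → E3) (a : E3) : IsWorkBetween Ω G a a 0 := by
  intro δ hδ
  refine ⟨1, one_pos, fun η _ => ⟨fun _ => 0, contDiff_const, HasCompactSupport.zero, ?_, ?_, ?_⟩⟩
  · simp [tsupport, Function.support]
  · intro x
    simp [divergence, partialD]
  · simpa using hδ

theorem IsWorkBetween.symm (h : IsWorkBetween Ω G a b r) : IsWorkBetween Ω G b a (-r) := by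
  intro δ hδ
  obtain ⟨R, hR, H⟩ := h δ hδ
  refine ⟨R, hR, fun η hη => ?_⟩
  obtain ⟨φ, h1, h2, h3, h4, h5⟩ := H η hη
  have hsub : tsupport (fun x => (-1 : ℝ) • φ x) ⊆ tsupport φ :=
    closure_mono fun x hx h0 => hx (by simp [h0])
  refine ⟨fun x => (-1 : ℝ) • φ x, h1.const_smul (-1 : ℝ), h2.mono' fun x hx => ?_,
    hsub.trans h3, fun x => ?_, ?_⟩
  · exact hsub (subset_tsupport _ hx)
  · rw [divergence_const_smul _ (h1.differentiable (by simp) x), h4]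
    ring
  · simp only [inner_smul_right, integral_const_mul]
    rw [← abs_neg]
    convert h5 using 2
    ring

theorem IsWorkBetween.trans (hG : ContinuousOn G Ω) (h : IsWorkBetween Ω G a b r)
    (h' : IsWorkBetween Ω G b c r') : IsWorkBetween Ω G a c (r + r') := by
  intro δ hδ
  obtain ⟨R, hR, H⟩ := h (δ / 2) (half_pos hδ)
  obtain ⟨R', hR', H'⟩ := h' (δ / 2) (half_pos hδ)
  refine ⟨min R R', lt_min hR hR', fun η hη => ?_⟩
  obtain ⟨φ, h1, h2, h3, h4, h5⟩ := H η (hη.trans_le (min_le_left _ _))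
  obtain ⟨φ', h1', h2', h3', h4', h5'⟩ := H' η (hη.trans_le (min_le_right _ _))
  refine ⟨fun x => φ x + φ' x, h1.add h1', h2.add h2',
    (tsupport_add φ φ').trans (Set.union_subset h3 h3'), fun x => ?_, ?_⟩
  · rw [divergence_add (h1.differentiable (by simp) x) (h1'.differentiable (by simp) x), h4, h4']
    ring
  · simp only [inner_add_right]
    rw [integral_add (integrable_inner_of_tsupport_subset hG h1.continuous h2 h3)
      (integrable_inner_of_tsupport_subset hG h1'.continuous h2' h3')]
    rw [abs_lt] at h5 h5' ⊢
    constructor <;> linarith [h5.1, h5.2, h5'.1, h5'.2]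

/-- A closed unit flux is solenoidal, so a field orthogonal to solenoidal test fields does no work
along it. -/
theorem IsWorkBetween.eq_zero
    (hsol : ∀ φ, IsSolenoidalTestField Ω φ → ∫ x, inner ℝ (G x) (φ x) = 0)
    (h : IsWorkBetween Ω G a a r) : r = 0 := by
  by_contra hr
  obtain ⟨R, hR, H⟩ := h |r| (abs_pos.2 hr)
  -- any bump of radius less than `R` will do
  obtain ⟨φ, h1, h2, h3, h4, h5⟩ := H ⟨R / 4, R / 2, by positivity, by linarith⟩ (half_lt_self hR)
  rw [hsol φ ⟨h1, h2, h3, fun x => by rw [h4, sub_self]⟩, zero_sub, abs_neg] at h5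
  exact lt_irrefl _ h5

theorem IsWorkBetween.unique (hG : ContinuousOn G Ω)
    (hsol : ∀ φ, IsSolenoidalTestField Ω φ → ∫ x, inner ℝ (G x) (φ x) = 0)
    (h : IsWorkBetween Ω G a b r) (h' : IsWorkBetween Ω G a b r') : r = r' := by
  have := (h.trans hG h'.symm).eq_zero hsol
  linarith

/-- On a segment inside the domain the work is the line integral. -/
theorem isWorkBetween_segment (hΩ : IsOpen Ω) (hG : ContinuousOn G Ω)
    (hab : segment ℝ a b ⊆ Ω) :
    IsWorkBetween Ω G a b (∫ᶜ x in Path.segment a b, innerSL ℝ (G x)) := by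
  intro δ hδ
  obtain ⟨w, rfl⟩ : ∃ w, b = a + w := ⟨b - a, by abel⟩
  have hseg : IsCompact (segment ℝ a (a + w)) := by
    rw [segment_eq_image']
    exact isCompact_Icc.image (by fun_prop)
  obtain ⟨R₀, hR₀, hsub⟩ := hseg.exists_cthickening_subset_open hΩ hab
  have hK : IsCompact (Metric.cthickening R₀ (segment ℝ a (a + w))) := hseg.cthickening
  have hg : ContinuousOn (fun x => inner ℝ (G x) w) (Metric.cthickening R₀ (segment ℝ a (a + w))) :=
    (hG.mono hsub).inner continuousOn_const
  obtain ⟨R₁, hR₁, hu⟩ := Metric.uniformContinuousOn_iff.1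
    (hK.uniformContinuousOn_of_continuous hg) (δ / 2) (half_pos hδ)
  refine ⟨min R₀ R₁, lt_min hR₀ hR₁, fun η hη => ?_⟩
  have hη₀ := hη.trans_le (min_le_left _ _)
  have hη₁ := hη.trans_le (min_le_right _ _)
  set ψ := segmentDensity (η.normed volume) a w with hψdef
  have hψ : ContDiff ℝ ∞ ψ :=
    contDiff_segmentDensity η.contDiff_normed η.hasCompactSupport_normed a w
  have hsub' := Metric.cthickening_mono hη₀.le (segment ℝ a (a + w))
  have hsupp : Function.support (η.normed volume) = Metric.ball 0 η.rOut := η.support_normed_eq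
  have hts : tsupport (fun x => ψ x • w) ⊆ Metric.cthickening R₀ (segment ℝ a (a + w)) := by
    refine closure_minimal (fun x hx => hsub'
      (support_segmentDensity_subset hsupp.subset a w fun h0 => hx ?_))
      Metric.isClosed_cthickening
    change ψ x • w = 0
    rw [hψdef, h0, zero_smul]
  refine ⟨fun x => ψ x • w, hψ.smul contDiff_const, ?_, hts.trans hsub, fun x => ?_, ?_⟩
  · exact hK.of_isClosed_subset (isClosed_tsupport _) hts
  · rw [divergence_smul_const _ (hψ.differentiable (by simp) x),
      fderiv_segmentDensity η.contDiff_normed η.hasCompactSupport_normed]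
  · have h := abs_integral_segmentDensity_sub_le hK hsub' hg
      fun x hx y hy hxy => (hu x hx y hy (hxy.trans hη₁)).le
    refine lt_of_le_of_lt ?_ (half_lt_self hδ)
    have eφ : ∫ x, inner ℝ (G x) (ψ x • w) = ∫ x, inner ℝ (G x) w * ψ x := by
      refine integral_congr_ae (.of_forall fun x => ?_)
      simp only [inner_smul_right]
      ring
    have eγ : ∫ᶜ x in Path.segment a (a + w), innerSL ℝ (G x)
        = ∫ s in (0 : ℝ)..1, inner ℝ (G (a + s • w)) w := by
      rw [curveIntegral_segment]
      refine intervalIntegral.integral_congr fun s _ => ?_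
      simp [AffineMap.lineMap_apply, add_comm]
    rw [eφ, eγ]
    exact h

/-- Any two points of a connected open set are joined by a unit flux. -/
theorem exists_isWorkBetween (hΩ : IsOpen Ω) (hc : IsPreconnected Ω) (hG : ContinuousOn G Ω)
    (ha : a ∈ Ω) (hb : b ∈ Ω) : ∃ r, IsWorkBetween Ω G a b r := by
  let U : Set E3 := {x | x ∈ Ω ∧ ∃ r, IsWorkBetween Ω G a x r}
  let V : Set E3 := {x | x ∈ Ω ∧ ¬ ∃ r, IsWorkBetween Ω G a x r}
  have hball : ∀ x ∈ Ω, ∃ R > 0, ∀ y ∈ Metric.ball x R, y ∈ Ω ∧ ∃ r, IsWorkBetween Ω G x y r := by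
    intro x hx
    obtain ⟨R, hR, hsub⟩ := Metric.isOpen_iff.1 hΩ x hx
    exact ⟨R, hR, fun y hy => ⟨hsub hy, _, isWorkBetween_segment hΩ hG
      (((convex_ball x R).segment_subset (Metric.mem_ball_self hR) hy).trans hsub)⟩⟩
  have hU : IsOpen U := by
    refine Metric.isOpen_iff.2 fun x ⟨hx, r, hr⟩ => ?_
    obtain ⟨R, hR, H⟩ := hball x hx
    refine ⟨R, hR, fun y hy => ?_⟩
    obtain ⟨hy, s, hs⟩ := H y hy
    exact ⟨hy, _, hr.trans hG hs⟩
  have hV : IsOpen V := by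
    refine Metric.isOpen_iff.2 fun x ⟨hx, hr⟩ => ?_
    obtain ⟨R, hR, H⟩ := hball x hx
    refine ⟨R, hR, fun y hy => ?_⟩
    obtain ⟨hy, s, hs⟩ := H y hy
    exact ⟨hy, fun ⟨r, hr'⟩ => hr ⟨_, hr'.trans hG hs.symm⟩⟩
  have hUV : Disjoint U V := Set.disjoint_left.2 fun x hx hx' => hx'.2 hx.2
  have hcover : Ω ⊆ U ∪ V := fun x hx => by
    by_cases h : ∃ r, IsWorkBetween Ω G a x r
    · exact .inl ⟨hx, h⟩
    · exact .inr ⟨hx, h⟩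
  exact (hc.subset_left_of_subset_union hU hV hUV hcover
    ⟨a, ha, ha, 0, IsWorkBetween.refl Ω G a⟩ hb).2

/-- A continuous field on a connected open set that is orthogonal to all solenoidal test fields has
a `C¹` potential. -/
theorem exists_gradient_eq_of_forall_solenoidal (hΩ : IsOpen Ω) (hc : IsConnected Ω)
    (hG : ContinuousOn G Ω)
    (hsol : ∀ φ, IsSolenoidalTestField Ω φ → ∫ x, inner ℝ (G x) (φ x) = 0) :
    ∃ σ : E3 → ℝ, ContDiffOn ℝ 1 σ Ω ∧ ∀ x ∈ Ω, gradient σ x = G x := by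
  obtain ⟨p, hp⟩ := hc.nonempty
  have hex : ∀ x, ∃ r, x ∈ Ω → IsWorkBetween Ω G p x r := fun x => by
    by_cases hx : x ∈ Ω
    · exact (exists_isWorkBetween hΩ hc.isPreconnected hG hp hx).imp fun _ h _ => h
    · exact ⟨0, fun h => absurd h hx⟩
  choose σ hσ using hex
  have hω : ContinuousOn (fun x => innerSL ℝ (G x)) Ω :=
    (innerSL ℝ (E := E3)).continuous.comp_continuousOn hG
  have hfd : ∀ x ∈ Ω, HasFDerivAt σ (innerSL ℝ (G x)) x := by
    intro x hx
    have h1 : HasFDerivAt (fun y => ∫ᶜ z in Path.segment x y, innerSL ℝ (G z))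
        (innerSL ℝ (G x)) x := by
      refine HasFDerivAt.curveIntegral_segment_source' ?_
      filter_upwards [hΩ.mem_nhds hx] with y hy using hω.continuousAt (hΩ.mem_nhds hy)
    obtain ⟨R, hR, hsub⟩ := Metric.isOpen_iff.1 hΩ x hx
    refine (h1.const_add (σ x)).congr_of_eventuallyEq ?_
    filter_upwards [Metric.ball_mem_nhds x hR] with y hy
    exact (hσ y (hsub hy)).unique hG hsol ((hσ x hx).trans hG (isWorkBetween_segment hΩ hG
      (((convex_ball x R).segment_subset (Metric.mem_ball_self hR) hy).trans hsub)))
  refine ⟨σ, ?_, fun x hx => ?_⟩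
  · rw [show (1 : WithTop ℕ∞) = 0 + 1 by simp, contDiffOn_succ_iff_fderiv_of_isOpen hΩ]
    refine ⟨fun x hx => (hfd x hx).differentiableAt.differentiableWithinAt, by simp, ?_⟩
    rw [contDiffOn_zero]
    exact hω.congr fun x hx => (hfd x hx).fderiv
  · exact HasGradientAt.gradient (by
      rw [hasGradientAt_iff_hasFDerivAt]
      exact hfd x hx)

end Potential

/-! ### Integration by parts for compactly supported fields -/

section IntegrationByParts

variable {Ω : Set E3} {f g : E3 → ℝ}

theorem integrable_mul_of_tsupport_subset (hf : ContinuousOn f Ω) (hg : Continuous g)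
    (hc : HasCompactSupport g) (hs : tsupport g ⊆ Ω) : Integrable fun x => f x * g x := by
  have h : IntegrableOn (fun x => f x * g x) (tsupport g) :=
    ((hf.mono hs).mul hg.continuousOn).integrableOn_compact hc
  refine (integrableOn_iff_integrable_of_support_subset fun x hx => ?_).1 h
  refine subset_tsupport g fun h0 => hx ?_
  simp [h0]

theorem integral_fderiv_apply_eq_zero {h : E3 → ℝ} {w : E3} (hd : Differentiable ℝ h)
    (hi : Integrable h) (hi' : Integrable fun x => fderiv ℝ h x w) :
    ∫ x, fderiv ℝ h x w = 0 := by
  have := integral_mul_fderiv_eq_neg_fderiv_mul_of_integrable (μ := volume)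
    (f := fun _ : E3 => (1 : ℝ)) (g := h) (v := w) (by simp) (by simpa using hi')
    (by simpa using hi) (fun _ _ => differentiableAt_const _) fun x _ => hd x
  simpa using this

theorem partialD_eq_zero_of_notMem_tsupport {X : Type*} [NormedAddCommGroup X] [NormedSpace ℝ X]
    {g : E3 → X} {x : E3} (hx : x ∉ tsupport g) (j : Fin 3) : partialD j g x = 0 := by
  rw [partialD, fderiv_of_notMem_tsupport ℝ hx]
  rfl

theorem continuousOn_partialD (hΩ : IsOpen Ω) (hf : ContDiffOn ℝ 1 f Ω) (j : Fin 3) :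
    ContinuousOn (partialD j f) Ω :=
  (hf.continuousOn_fderiv_of_isOpen hΩ le_rfl).clm_apply continuousOn_const

/-- `f` need only be regular on `Ω`: the product `f * g`, extended by zero, is differentiable on the
whole space, and its derivative has integral zero. -/
theorem integral_mul_partialD (hΩ : IsOpen Ω) (hf : ContDiffOn ℝ 1 f Ω) (hg : ContDiff ℝ 1 g)
    (hc : HasCompactSupport g) (hs : tsupport g ⊆ Ω) (j : Fin 3) :
    ∫ x, f x * partialD j g x = -∫ x, partialD j f x * g x := by
  have hgd : Differentiable ℝ g := hg.differentiable (by simp)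
  have hfg : ∀ x, HasFDerivAt (fun y => f y * g y) (f x • fderiv ℝ g x + g x • fderiv ℝ f x) x := by
    intro x
    by_cases hx : x ∈ Ω
    · exact ((hf.differentiableOn (by simp)).differentiableAt (hΩ.mem_nhds hx)).hasFDerivAt.mul
        (hgd x).hasFDerivAt
    · have hx' : x ∉ tsupport g := fun h => hx (hs h)
      have hev := notMem_tsupport_iff_eventuallyEq.1 hx'
      rw [fderiv_of_notMem_tsupport ℝ hx', hev.self_of_nhds]
      simp only [Pi.zero_apply, smul_zero, zero_smul, add_zero]
      refine (hasFDerivAt_const (0 : ℝ) x).congr_of_eventuallyEq ?_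
      filter_upwards [hev] with y hy
      simp [hy]
  have hg' : Continuous (partialD j g) :=
    (hg.continuous_fderiv (by simp)).clm_apply continuous_const
  have hsub : tsupport (partialD j g) ⊆ tsupport g :=
    closure_minimal (fun x hx => by
      by_contra h
      exact hx (partialD_eq_zero_of_notMem_tsupport h j)) (isClosed_tsupport g)
  have i1 : Integrable fun x => f x * partialD j g x :=
    integrable_mul_of_tsupport_subset hf.continuousOn hg'
      (hc.of_isClosed_subset (isClosed_tsupport _) hsub) (hsub.trans hs)
  have i2 : Integrable fun x => partialD j f x * g x :=
    integrable_mul_of_tsupport_subset (continuousOn_partialD hΩ hf j) hg.continuous hc hs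
  have e : ∀ x, fderiv ℝ (fun y => f y * g y) x (EuclideanSpace.single j 1)
      = f x * partialD j g x + partialD j f x * g x := fun x => by
    rw [(hfg x).fderiv]
    simp [partialD, mul_comm]
  have h0 := integral_fderiv_apply_eq_zero (h := fun y => f y * g y)
    (w := EuclideanSpace.single j 1) (fun x => (hfg x).differentiableAt)
    (integrable_mul_of_tsupport_subset hf.continuousOn hg.continuous hc hs)
    (by simp only [e]; exact i1.add i2)
  simp only [e] at h0
  rw [integral_add i1 i2] at h0
  linarith

end IntegrationByParts

section Frobenius

variable {Ω : Set E3}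

/-- The Frobenius product `A : B`. -/
def frobenius (A B : Matrix (Fin 3) (Fin 3) ℝ) : ℝ :=
  ∑ i, ∑ j, A i j * B i j

theorem matNormSq_add_smul (A B : Matrix (Fin 3) (Fin 3) ℝ) (s : ℝ) :
    matNormSq (A + s • B) = matNormSq A + 2 * s * frobenius A B + s ^ 2 * matNormSq B := by
  simp only [matNormSq, frobenius, Finset.mul_sum, ← Finset.sum_add_distrib]
  refine Finset.sum_congr rfl fun i _ => Finset.sum_congr rfl fun j _ => ?_
  simp only [Matrix.add_apply, Matrix.smul_apply, smul_eq_mul]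
  ring

/-- `D₊V : ∇φ = D₊V : D₊φ` and `D₋V : ∇φ = D₋V : D₋φ`, because symmetric and antisymmetric matrices
are orthogonal for the Frobenius product. -/
theorem frobenius_viscousStress_gradMat (e₁ e₃ : ℝ → ℝ) (V φ : E3 → E3) (x : E3) :
    frobenius (viscousStress e₁ e₃ V x) (gradMat φ x)
      = deriv e₁ (matNormSq (strainRate V x)) * frobenius (strainRate V x) (strainRate φ x)
        + deriv e₃ (matNormSq (vorticity V x)) * frobenius (vorticity V x) (vorticity φ x) := by
  unfold viscousStress
  generalize deriv e₁ (matNormSq (strainRate V x)) = α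
  generalize deriv e₃ (matNormSq (vorticity V x)) = β
  simp only [frobenius, strainRate, vorticity, Matrix.add_apply, Matrix.sub_apply,
    Matrix.smul_apply, Matrix.transpose_apply, smul_eq_mul, Fin.sum_univ_three]
  ring

theorem integral_frobenius_gradMat (hΩ : IsOpen Ω) {S : E3 → Matrix (Fin 3) (Fin 3) ℝ}
    (hS : ∀ i j, ContDiffOn ℝ 1 (fun x => S x i j) Ω) {φ : E3 → E3} (hφ : ContDiff ℝ ∞ φ)
    (hc : HasCompactSupport φ) (hs : tsupport φ ⊆ Ω) :
    ∫ x, frobenius (S x) (gradMat φ x) = -∫ x, inner ℝ (matDiv S x) (φ x) := by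
  have hφi : ∀ i, ContDiff ℝ 1 fun x => φ x i := fun i => by
    have : ContDiff ℝ 1 φ := hφ.of_le (by simp)
    fun_prop
  have hsub : ∀ i, tsupport (fun x => φ x i) ⊆ tsupport φ := fun i =>
    closure_mono fun x hx h0 => hx (by simp [h0])
  have hci : ∀ i, HasCompactSupport fun x => φ x i := fun i =>
    hc.of_isClosed_subset (isClosed_tsupport _) (hsub i)
  have hsub' : ∀ i j, tsupport (partialD j fun x => φ x i) ⊆ tsupport φ := fun i j =>
    closure_minimal (fun x hx => by
      by_contra h
      exact hx (partialD_eq_zero_of_notMem_tsupport (fun h' => h (hsub i h')) j))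
      (isClosed_tsupport φ)
  have i1 : ∀ i j, Integrable fun x => S x i j * partialD j (fun y => φ y i) x := fun i j =>
    integrable_mul_of_tsupport_subset (hS i j).continuousOn
      (((hφi i).continuous_fderiv (by simp)).clm_apply continuous_const)
      (hc.of_isClosed_subset (isClosed_tsupport _) (hsub' i j)) ((hsub' i j).trans hs)
  have i2 : ∀ i j, Integrable fun x => partialD j (fun y => S y i j) x * φ x i := fun i j =>
    integrable_mul_of_tsupport_subset (continuousOn_partialD hΩ (hS i j) j) (hφi i).continuous
      (hci i) ((hsub i).trans hs)
  have e1 : ∫ x, frobenius (S x) (gradMat φ x)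
      = ∑ i, ∑ j, ∫ x, S x i j * partialD j (fun y => φ y i) x := by
    simp only [frobenius, gradMat, Matrix.of_apply]
    rw [integral_finsetSum _ fun i _ => integrable_finsetSum _ fun j _ => i1 i j]
    exact Finset.sum_congr rfl fun i _ => integral_finsetSum _ fun j _ => i1 i j
  have e2 : ∫ x, inner ℝ (matDiv S x) (φ x)
      = ∑ i, ∑ j, ∫ x, partialD j (fun y => S y i j) x * φ x i := by
    have : ∀ x, inner ℝ (matDiv S x) (φ x)
        = ∑ i, ∑ j, partialD j (fun y => S y i j) x * φ x i := fun x => by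
      simp only [matDiv, PiLp.inner_apply, RCLike.inner_apply, conj_trivial, ← Finset.sum_mul]
      exact Finset.sum_congr rfl fun i _ => mul_comm _ _
    simp only [this]
    rw [integral_finsetSum _ fun i _ => integrable_finsetSum _ fun j _ => i2 i j]
    exact Finset.sum_congr rfl fun i _ => integral_finsetSum _ fun j _ => i2 i j
  rw [e1, e2, ← Finset.sum_neg_distrib]
  refine Finset.sum_congr rfl fun i _ => ?_
  rw [← Finset.sum_neg_distrib]
  exact Finset.sum_congr rfl fun j _ =>
    integral_mul_partialD hΩ (hS i j) (hφi i) (hci i) ((hsub i).trans hs) j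

end Frobenius

/-! ### The first variation of the energy -/

/-- The argument of `e` has the shape of `|A + s B|²` as a function of `s`. -/
theorem hasDerivAt_integral_comp_quadratic {e : ℝ → ℝ} (he : ContDiff ℝ 1 e) {K : Set E3}
    (hK : IsCompact K) {q b c : E3 → ℝ} (hq : ContinuousOn q K) (hb : ContinuousOn b K)
    (hc : ContinuousOn c K) :
    HasDerivAt (fun s : ℝ => ∫ x in K, e (q x + 2 * s * b x + s ^ 2 * c x))
      (∫ x in K, deriv e (q x) * (2 * b x)) 0 := by
  have he' : Continuous (deriv e) := he.continuous_deriv le_rfl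
  let D : ℝ → E3 → ℝ := fun s x =>
    deriv e (q x + 2 * s * b x + s ^ 2 * c x) * (2 * b x + 2 * s * c x)
  have hD : ContinuousOn (fun p : ℝ × E3 => D p.1 p.2) (Set.Icc (-1) 1 ×ˢ K) := by
    have hm : Set.MapsTo (Prod.snd : ℝ × E3 → E3) (Set.Icc (-1) 1 ×ˢ K) K := fun p hp => hp.2
    have hq' := hq.comp continuousOn_snd hm
    have hb' := hb.comp continuousOn_snd hm
    have hc' := hc.comp continuousOn_snd hm
    simp only [Function.comp_def] at hq' hb' hc'
    exact (he'.comp_continuousOn (by fun_prop)).mul (by fun_prop)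
  obtain ⟨C, hC⟩ := (isCompact_Icc.prod hK).exists_bound_of_continuousOn hD
  have hF : ∀ s : ℝ, ContinuousOn (fun x => e (q x + 2 * s * b x + s ^ 2 * c x)) K := fun s =>
    he.continuous.comp_continuousOn (by fun_prop)
  have hfin : IsFiniteMeasure (volume.restrict K) :=
    isFiniteMeasure_restrict.2 hK.measure_lt_top.ne
  have hderiv : ∀ (x : E3) (s : ℝ),
      HasDerivAt (fun s : ℝ => e (q x + 2 * s * b x + s ^ 2 * c x)) (D s x) s := by
    intro x s
    have h1 : HasDerivAt (fun s : ℝ => q x + 2 * s * b x) (2 * 1 * b x) s :=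
      (((hasDerivAt_id s).const_mul 2).mul_const (b x)).const_add (q x)
    have h2 : HasDerivAt (fun s : ℝ => q x + 2 * s * b x + s ^ 2 * c x)
        (2 * b x + 2 * s * c x) s := by
      exact (h1.add ((hasDerivAt_pow 2 s).mul_const (c x))).congr_deriv (by simp)
    exact ((he.differentiable (by simp)) _).hasDerivAt.comp s h2
  have hD₀ : ContinuousOn (D 0) K :=
    hD.comp (f := fun x => ((0 : ℝ), x)) (by fun_prop) fun x hx => ⟨by simp, hx⟩
  have h := (hasDerivAt_integral_of_dominated_loc_of_deriv_le (μ := volume.restrict K)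
    (F := fun s x => e (q x + 2 * s * b x + s ^ 2 * c x)) (F' := D) (x₀ := 0)
    (bound := fun _ => C) (Icc_mem_nhds (by norm_num : (-1 : ℝ) < 0) one_pos)
    (.of_forall fun s => (hF s).aestronglyMeasurable hK.measurableSet)
    ((hF 0).integrableOn_compact hK) (hD₀.aestronglyMeasurable hK.measurableSet)
    ((ae_restrict_iff' hK.measurableSet).2 (.of_forall fun x hx s hs => hC (s, x) ⟨hs, hx⟩))
    (integrable_const C) (.of_forall fun x s _ => hderiv x s)).2
  refine h.congr_deriv (integral_congr_ae (.of_forall fun x => ?_))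
  simp [D]

theorem gradMat_add_smul {V φ : E3 → E3} {x : E3} (s : ℝ) (hV : DifferentiableAt ℝ V x)
    (hφ : DifferentiableAt ℝ φ x) :
    gradMat (fun y => V y + s • φ y) x = gradMat V x + s • gradMat φ x := by
  ext i j
  have hVi : DifferentiableAt ℝ (fun y => V y i) x := by fun_prop
  have hφi : DifferentiableAt ℝ (fun y => φ y i) x := by fun_prop
  simp only [gradMat, partialD, Matrix.of_apply, Matrix.add_apply, Matrix.smul_apply,
    PiLp.add_apply, PiLp.smul_apply, smul_eq_mul]
  rw [fderiv_fun_add hVi (hφi.const_mul s), fderiv_const_mul hφi]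
  rfl

theorem strainRate_add_smul {V φ : E3 → E3} {x : E3} (s : ℝ) (hV : DifferentiableAt ℝ V x)
    (hφ : DifferentiableAt ℝ φ x) :
    strainRate (fun y => V y + s • φ y) x = strainRate V x + s • strainRate φ x := by
  rw [strainRate, gradMat_add_smul s hV hφ, strainRate, strainRate, Matrix.transpose_add,
    Matrix.transpose_smul]
  module

theorem vorticity_add_smul {V φ : E3 → E3} {x : E3} (s : ℝ) (hV : DifferentiableAt ℝ V x)
    (hφ : DifferentiableAt ℝ φ x) :
    vorticity (fun y => V y + s • φ y) x = vorticity V x + s • vorticity φ x := by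
  rw [vorticity, gradMat_add_smul s hV hφ, vorticity, vorticity, Matrix.transpose_add,
    Matrix.transpose_smul]
  module

variable {Ω : Set E3}

theorem continuousOn_gradMat (hΩ : IsOpen Ω) {V : E3 → E3} (hV : ContDiffOn ℝ 1 V Ω)
    (i j : Fin 3) : ContinuousOn (fun x => gradMat V x i j) Ω :=
  continuousOn_partialD (f := fun y => V y i) hΩ (by fun_prop) j

theorem continuousOn_strainRate (hΩ : IsOpen Ω) {V : E3 → E3} (hV : ContDiffOn ℝ 1 V Ω)
    (i j : Fin 3) : ContinuousOn (fun x => strainRate V x i j) Ω := by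
  have h := continuousOn_gradMat hΩ hV
  simp only [strainRate, Matrix.smul_apply, Matrix.add_apply, Matrix.transpose_apply]
  exact ((h i j).add (h j i)).const_smul (1 / 2 : ℝ)

theorem continuousOn_vorticity (hΩ : IsOpen Ω) {V : E3 → E3} (hV : ContDiffOn ℝ 1 V Ω)
    (i j : Fin 3) : ContinuousOn (fun x => vorticity V x i j) Ω := by
  have h := continuousOn_gradMat hΩ hV
  simp only [vorticity, Matrix.smul_apply, Matrix.sub_apply, Matrix.transpose_apply]
  exact ((h i j).sub (h j i)).const_smul (1 / 2 : ℝ)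

theorem continuousOn_frobenius {A B : E3 → Matrix (Fin 3) (Fin 3) ℝ}
    (hA : ∀ i j, ContinuousOn (fun x => A x i j) Ω)
    (hB : ∀ i j, ContinuousOn (fun x => B x i j) Ω) :
    ContinuousOn (fun x => frobenius (A x) (B x)) Ω :=
  continuousOn_finsetSum _ fun i _ => continuousOn_finsetSum _ fun j _ => (hA i j).mul (hB i j)

theorem gradMat_eq_zero_of_notMem_tsupport {φ : E3 → E3} {x : E3} (hx : x ∉ tsupport φ) :
    gradMat φ x = 0 := by
  ext i j
  exact partialD_eq_zero_of_notMem_tsupport (fun h => hx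
    (closure_mono (Function.support_subset_iff'.2 fun y hy => by
      simp [Function.notMem_support.1 hy]) h)) j

theorem continuousOn_matDiv (hΩ : IsOpen Ω) {S : E3 → Matrix (Fin 3) (Fin 3) ℝ}
    (hS : ∀ i j, ContDiffOn ℝ 1 (fun x => S x i j) Ω) : ContinuousOn (matDiv S) Ω :=
  (PiLp.continuous_toLp 2 _).comp_continuousOn (continuousOn_pi.2 fun i =>
    continuousOn_finsetSum _ fun j _ => continuousOn_partialD hΩ (hS i j) j)

section FirstVariation

variable {e₁ e₂ e₃ : ℝ → ℝ} {V φ : E3 → E3}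

/-- First variation of the dissipation energy at a solenoidal field, along solenoidal test
fields. Outside the support of `φ` the density does not vary, so that differentiation under the
integral takes place over a compact set. -/
theorem hasDerivAt_dissipationEnergy (hΩ : IsOpen Ω) (he₁ : ContDiff ℝ 1 e₁)
    (he₃ : ContDiff ℝ 1 e₃) (hV : ContDiffOn ℝ 1 V Ω)
    (hED : IntegrableOn (dissipationDensity e₁ e₂ e₃ V) Ω) (hdiv : ∀ x ∈ Ω, divergence V x = 0)
    (hφ : IsSolenoidalTestField Ω φ) :
    HasDerivAt (fun s : ℝ => dissipationEnergy e₁ e₂ e₃ Ω fun y => V y + s • φ y)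
      (-∫ x, frobenius (viscousStress e₁ e₃ V x) (gradMat φ x)) 0 := by
  set K := tsupport φ with hKdef
  have hK : IsCompact K := hφ.hasCompactSupport
  have hKΩ : K ⊆ Ω := hφ.tsupport_subset
  have hφ1 : ContDiff ℝ 1 φ := hφ.smooth.of_le (by simp)
  have hφd : Differentiable ℝ φ := hφ1.differentiable (by simp)
  have hVd : ∀ x ∈ Ω, DifferentiableAt ℝ V x := fun x hx =>
    (hV.differentiableOn (by simp)).differentiableAt (hΩ.mem_nhds hx)
  let b₁ : E3 → ℝ := fun x => frobenius (strainRate V x) (strainRate φ x)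
  let b₃ : E3 → ℝ := fun x => frobenius (vorticity V x) (vorticity φ x)
  let f₁ : ℝ → E3 → ℝ := fun s x => e₁ (matNormSq (strainRate V x) + 2 * s * b₁ x
    + s ^ 2 * matNormSq (strainRate φ x))
  let f₃ : ℝ → E3 → ℝ := fun s x => e₃ (matNormSq (vorticity V x) + 2 * s * b₃ x
    + s ^ 2 * matNormSq (vorticity φ x))
  have hdens : ∀ s : ℝ, ∀ x ∈ Ω, dissipationDensity e₁ e₂ e₃ (fun y => V y + s • φ y) x
      = 1 / 2 * (f₁ s x + e₂ 0 + f₃ s x) := by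
    intro s x hx
    have hd : divergence (fun y => V y + s • φ y) x = 0 := by
      rw [divergence_add_smul s (hVd x hx) (hφd x), hdiv x hx, hφ.divergence_eq_zero]
      simp
    rw [dissipationDensity, strainRate_add_smul s (hVd x hx) (hφd x),
      vorticity_add_smul s (hVd x hx) (hφd x), matNormSq_add_smul, matNormSq_add_smul, hd]
    simp [f₁, f₃, b₁, b₃]
  have hoff : ∀ s : ℝ, ∀ x ∈ Ω \ K, dissipationDensity e₁ e₂ e₃ (fun y => V y + s • φ y) x
      = dissipationDensity e₁ e₂ e₃ V x := by
    intro s x hx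
    have h0 := gradMat_eq_zero_of_notMem_tsupport hx.2
    have h1 : strainRate φ x = 0 := by simp [strainRate, h0]
    have h3 : vorticity φ x = 0 := by simp [vorticity, h0]
    have hd : divergence (fun y => V y + s • φ y) x = divergence V x := by
      rw [divergence_add_smul s (hVd x hx.1) (hφd x), hφ.divergence_eq_zero]
      simp
    rw [dissipationDensity, strainRate_add_smul s (hVd x hx.1) (hφd x),
      vorticity_add_smul s (hVd x hx.1) (hφd x), h1, h3, hd]
    simp [dissipationDensity]
  have hcV₁ := continuousOn_strainRate hΩ hV
  have hcV₃ := continuousOn_vorticity hΩ hV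
  have hcφ₁ := continuousOn_strainRate hΩ hφ1.contDiffOn
  have hcφ₃ := continuousOn_vorticity hΩ hφ1.contDiffOn
  have hq₁ : ContinuousOn (fun x => matNormSq (strainRate V x)) K :=
    (continuousOn_frobenius hcV₁ hcV₁).mono hKΩ
  have hq₃ : ContinuousOn (fun x => matNormSq (vorticity V x)) K :=
    (continuousOn_frobenius hcV₃ hcV₃).mono hKΩ
  have hc₁ : ContinuousOn (fun x => matNormSq (strainRate φ x)) K :=
    (continuousOn_frobenius hcφ₁ hcφ₁).mono hKΩ
  have hc₃ : ContinuousOn (fun x => matNormSq (vorticity φ x)) K :=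
    (continuousOn_frobenius hcφ₃ hcφ₃).mono hKΩ
  have hb₁ : ContinuousOn b₁ K := (continuousOn_frobenius hcV₁ hcφ₁).mono hKΩ
  have hb₃ : ContinuousOn b₃ K := (continuousOn_frobenius hcV₃ hcφ₃).mono hKΩ
  have hi₁ : ∀ s, IntegrableOn (f₁ s) K := fun s =>
    (he₁.continuous.comp_continuousOn (by fun_prop)).integrableOn_compact hK
  have hi₃ : ∀ s, IntegrableOn (f₃ s) K := fun s =>
    (he₃.continuous.comp_continuousOn (by fun_prop)).integrableOn_compact hK
  have hi₂ : IntegrableOn (fun _ : E3 => e₂ 0) K := continuousOn_const.integrableOn_compact hK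
  have hmeas : MeasurableSet (Ω \ K) := hΩ.measurableSet.diff hK.measurableSet
  have hsplit : ∀ s : ℝ, dissipationEnergy e₁ e₂ e₃ Ω (fun y => V y + s • φ y)
      = -(1 / 2 * ((∫ x in K, f₁ s x) + (∫ x in K, e₂ 0) + ∫ x in K, f₃ s x)
        + ∫ x in Ω \ K, dissipationDensity e₁ e₂ e₃ V x) := by
    intro s
    have hiK : IntegrableOn (dissipationDensity e₁ e₂ e₃ fun y => V y + s • φ y) K :=
      IntegrableOn.congr_fun ((((hi₁ s).add hi₂).add (hi₃ s)).const_mul (1 / 2))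
        (fun x hx => (hdens s x (hKΩ hx)).symm) hK.measurableSet
    have hioff : IntegrableOn (dissipationDensity e₁ e₂ e₃ fun y => V y + s • φ y) (Ω \ K) :=
      IntegrableOn.congr_fun (hED.mono_set Set.sdiff_subset) (fun x hx => (hoff s x hx).symm) hmeas
    rw [dissipationEnergy, ← setIntegral_congr_fun hmeas (hoff s)]
    conv_lhs => rw [← Set.union_sdiff_cancel hKΩ]
    rw [setIntegral_union Set.disjoint_sdiff_right hmeas hiK hioff,
      setIntegral_congr_fun hK.measurableSet fun x hx => hdens s x (hKΩ hx),
      integral_const_mul, integral_add (f := fun x => f₁ s x + e₂ 0) ((hi₁ s).add hi₂) (hi₃ s),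
      integral_add (hi₁ s) hi₂]
  have hd₁ := hasDerivAt_integral_comp_quadratic he₁ hK hq₁ hb₁ hc₁
  have hd₃ := hasDerivAt_integral_comp_quadratic he₃ hK hq₃ hb₃ hc₃
  have he₁' := he₁.continuous_deriv le_rfl
  have he₃' := he₃.continuous_deriv le_rfl
  have hj₁ : IntegrableOn (fun x => deriv e₁ (matNormSq (strainRate V x)) * (2 * b₁ x)) K :=
    ((he₁'.comp_continuousOn hq₁).mul (by fun_prop)).integrableOn_compact hK
  have hj₃ : IntegrableOn (fun x => deriv e₃ (matNormSq (vorticity V x)) * (2 * b₃ x)) K :=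
    ((he₃'.comp_continuousOn hq₃).mul (by fun_prop)).integrableOn_compact hK
  have hvalue : ∫ x, frobenius (viscousStress e₁ e₃ V x) (gradMat φ x)
      = 1 / 2 * ((∫ x in K, deriv e₁ (matNormSq (strainRate V x)) * (2 * b₁ x))
        + ∫ x in K, deriv e₃ (matNormSq (vorticity V x)) * (2 * b₃ x)) := by
    rw [← integral_add hj₁ hj₃, ← integral_const_mul,
      ← setIntegral_eq_integral_of_forall_compl_eq_zero (s := K) fun x hx => by
        simp [gradMat_eq_zero_of_notMem_tsupport hx, frobenius]]
    refine integral_congr_ae (.of_forall fun x => ?_)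
    simp only [frobenius_viscousStress_gradMat, b₁, b₃]
    ring
  rw [hvalue, funext hsplit]
  exact ((((hd₁.add_const _).add hd₃).const_mul (1 / 2)).add_const _).neg

/-- The work is affine along solenoidal test fields. -/
theorem hasDerivAt_workEnergy (hΩ : IsOpen Ω) {σ ρ : E3 → ℝ} {F : E3 → E3}
    (hρ : ContinuousOn ρ Ω) (hF : ContinuousOn F Ω) (hV : ContDiffOn ℝ 1 V Ω)
    (hEW : IntegrableOn (powerDensity σ ρ F V) Ω) (hφ : IsSolenoidalTestField Ω φ) :
    HasDerivAt (fun s : ℝ => workEnergy σ ρ F Ω fun y => V y + s • φ y)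
      (∫ x, inner ℝ (ρ x • F x) (φ x)) 0 := by
  have hφd : Differentiable ℝ φ := hφ.smooth.differentiable (by simp)
  have hi : Integrable fun x => inner ℝ (ρ x • F x) (φ x) :=
    integrable_inner_of_tsupport_subset (hρ.smul hF) hφ.smooth.continuous hφ.hasCompactSupport
      hφ.tsupport_subset
  have h : ∀ s : ℝ, workEnergy σ ρ F Ω (fun y => V y + s • φ y)
      = workEnergy σ ρ F Ω V + s * ∫ x, inner ℝ (ρ x • F x) (φ x) := by
    intro s
    rw [← setIntegral_eq_integral_of_forall_compl_eq_zero (s := Ω) fun x hx => by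
        rw [image_eq_zero_of_notMem_tsupport fun h => hx (hφ.tsupport_subset h), inner_zero_right],
      workEnergy, workEnergy, ← integral_const_mul,
      ← integral_add hEW (hi.integrableOn.const_mul s)]
    refine setIntegral_congr_fun hΩ.measurableSet fun x hx => ?_
    have hVd : DifferentiableAt ℝ V x :=
      (hV.differentiableOn (by simp)).differentiableAt (hΩ.mem_nhds hx)
    simp only [powerDensity]
    rw [divergence_add_smul s hVd (hφd x), hφ.divergence_eq_zero, inner_add_right, inner_smul_right, real_inner_smul_left]
    ring
  rw [funext h]
  simpa using ((hasDerivAt_id (0 : ℝ)).mul_const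
    (∫ x, inner ℝ (ρ x • F x) (φ x))).const_add (workEnergy σ ρ F Ω V)

end FirstVariation

end NonNewtonian

theorem theorem2p3
    (T : EReal) (Ω : ℝ → Set NonNewtonian.E3)
    (hΩ : ∀ s : ℝ, 0 ≤ s → (s : EReal) < T → NonNewtonian.IsBoundedC2Domain (Ω s))
    (e₁ e₂ e₃ : ℝ → ℝ)
    (he₁ : ContDiff ℝ 1 e₁) (he₂ : ContDiff ℝ 1 e₂) (he₃ : ContDiff ℝ 1 e₃)
    (ρ σ₀ : NonNewtonian.E3 → ℝ → ℝ) (v F : NonNewtonian.E3 → ℝ → NonNewtonian.E3)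
    (t : ℝ) (ht₀ : 0 < t) (htT : (t : EReal) < T)
    -- the fields are `C¹` in the space variable at the fixed time `t`
    (hρ : ContDiffOn ℝ 1 (fun x => ρ x t) (Ω t))
    (hσ₀ : ContDiffOn ℝ 1 (fun x => σ₀ x t) (Ω t))
    (hF : ContDiffOn ℝ 1 (fun x => F x t) (Ω t))
    (hv : ContDiffOn ℝ 1 (fun x => v x t) (Ω t))
    -- the viscous stress is `C¹`, so that its divergence is a classical one
    (hS : ∀ i j, ContDiffOn ℝ 1
      (fun x => NonNewtonian.viscousStress e₁ e₃ (fun y => v y t) x i j) (Ω t))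
    -- the integrals that define `E_D[v](t)` and `E_W[v](t)` converge
    (hED : MeasureTheory.IntegrableOn
      (NonNewtonian.dissipationDensity e₁ e₂ e₃ (fun y => v y t)) (Ω t))
    (hEW : MeasureTheory.IntegrableOn
      (NonNewtonian.powerDensity (fun y => σ₀ y t) (fun y => ρ y t) (fun y => F y t)
        (fun y => v y t)) (Ω t))
    (hdiv : ∀ x ∈ Ω t, NonNewtonian.divergence (fun y => v y t) x = 0)
    -- the first variation of `E_{D+W}` at `v` vanishes on solenoidal test fields
    (hvar : ∀ φ : NonNewtonian.E3 → NonNewtonian.E3,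
      NonNewtonian.IsSolenoidalTestField (Ω t) φ →
      HasDerivAt
        (fun ε : ℝ => NonNewtonian.totalEnergy e₁ e₂ e₃ (fun y => σ₀ y t) (fun y => ρ y t)
          (fun y => F y t) (Ω t) (fun y => v y t + ε • φ y)) 0 0) :
    ∃ σ : NonNewtonian.E3 → ℝ, ContDiffOn ℝ 1 σ (Ω t) ∧
      ∀ x ∈ Ω t,
        NonNewtonian.matDiv (NonNewtonian.viscousStress e₁ e₃ (fun y => v y t)) x
          + ρ x t • F x t = gradient σ x := by
  have hΩt := hΩ t ht₀.le htT
  have hopen := hΩt.isOpen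
  have hG : ContinuousOn (fun x => NonNewtonian.matDiv
      (NonNewtonian.viscousStress e₁ e₃ (fun y => v y t)) x + ρ x t • F x t) (Ω t) :=
    (NonNewtonian.continuousOn_matDiv hopen hS).add (hρ.continuousOn.smul hF.continuousOn)
  have hsol : ∀ φ, NonNewtonian.IsSolenoidalTestField (Ω t) φ →
      ∫ x, inner ℝ (NonNewtonian.matDiv
        (NonNewtonian.viscousStress e₁ e₃ (fun y => v y t)) x + ρ x t • F x t) (φ x) = 0 := by
    intro φ hφ
    have hφc := hφ.smooth.continuous
    simp only [inner_add_left]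
    rw [integral_add
      (NonNewtonian.integrable_inner_of_tsupport_subset
        (NonNewtonian.continuousOn_matDiv hopen hS) hφc hφ.hasCompactSupport hφ.tsupport_subset)
      (NonNewtonian.integrable_inner_of_tsupport_subset (G := fun x => ρ x t • F x t)
        (hρ.continuousOn.smul hF.continuousOn) hφc hφ.hasCompactSupport hφ.tsupport_subset),
      ← neg_neg (∫ x, inner ℝ (NonNewtonian.matDiv _ x) (φ x)),
      ← NonNewtonian.integral_frobenius_gradMat hopen hS hφ.smooth hφ.hasCompactSupport
        hφ.tsupport_subset]
    exact ((NonNewtonian.hasDerivAt_dissipationEnergy hopen he₁ he₃ hv hED hdiv hφ).add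
      (NonNewtonian.hasDerivAt_workEnergy hopen hρ.continuousOn hF.continuousOn hv hEW
        hφ)).unique (hvar φ hφ)
  obtain ⟨σ, hσ, hgrad⟩ := NonNewtonian.exists_gradient_eq_of_forall_solenoidal hopen
    hΩt.isConnected hG hsol
  exact ⟨σ, hσ, fun x hx => (hgrad x hx).symm⟩
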